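/- Let $\mathbf{k}$ be a field, let $k\in\mathbf{k}$ be a fixed nonzero scalar, and let $\mathcal{L}$ be a Lie algebra over $\mathbf{k}$ (of arbitrary dimension) with a basis $\{x_j \mid j\in J\}$ whose index set $J$ is totally ordered. Let $T$ be the free associative unital $\mathbf{k}$-algebra on the symbols $x_j$ ($j\in J$) and one further symbol $\tilde q$, and let $\hat A:=T/I$, where $I$ is the two-sided ideal generated by $\tilde q\tilde q-\tilde q$ and all $\tilde q a\tilde q-\tilde q a$ with $a\in T$. Write $\hat q$ and $\hat x_j$ for the images of $\tilde q$ and $x_j$ in $\hat A$, and let $\mathcal{L}\to\hat A$, $x\mapsto\hat x$, be the linear map with $x_j\mapsto\hat x_j$. For $u,v\in\hat A$ put $$[u,v]_{6,k}:=uv-vu-uv\hat q+vu\hat q+k\,u\hat q v-k\,v\hat q u .$$ Let $R$ be the two-sided ideal of $\hat A$ generated by all $\widehat{[x,y]}-[\hat x,\hat y]_{6,k}$ with $x,y\in\mathcal{L}$, and let $\mathcal{U}:=\hat A/R$ be the enveloping$^{6-th}$ algebra of $\mathcal{L}$. Then the following cosets of "model monomials" are pairwise distinct for different index data and form a $\mathbf{k}$-basis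 of $\mathcal{U}$: - $\hat q\,\hat x_{j_1}\cdots\hat x_{j_m}+R$, with $m\ge 0$ and $j_1\le\cdots\le j_m$; - $\hat x_{i_1}\cdots\hat x_{i_t}\,\hat x_{j_0}\,\hat q\,\hat x_{j_1}\cdots\hat x_{j_m}+R$, with $t,m\ge 0$, $i_1\le\cdots\le i_t$ and $j_0\le j_1\le\cdots\le j_m$; - $\hat x_{j_1}\cdots\hat x_{j_m}+R$, with $m\ge 0$ and $j_1\le\cdots\le j_m$. (Empty products are $1$.) -/

import Mathlib

/-- The bracket `[x, y]_{6,κ} = xy - yx - xyq + yxq + κ xqy - κ yqx` in an associative algebra `A`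
with a chosen element `q` (an idempotent in the applications). -/
def bracketSix {k A : Type*} [CommRing k] [Ring A] [Algebra k A] (κ : k) (q x y : A) : A :=
  x * y - y * x - x * y * q + y * x * q + κ • (x * q * y) - κ • (y * q * x)

/-- The relations `q̃ q̃ = q̃` and `q̃ a q̃ = q̃ a` (all `a`) on the free associative unital algebra
with generators `x_j` (`some j`) and `q̃` (`none`), that is, on the tensor algebra of the vector
space with basis `{x_j} ∪ {q̃}`. -/
inductive InvariantRel (k J : Type*) [Field k] :
    FreeAlgebra k (Option J) → FreeAlgebra k (Option J) → Prop
  | idem : InvariantRel k J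
      (FreeAlgebra.ι k none * FreeAlgebra.ι k none) (FreeAlgebra.ι k none)
  | inv (a : FreeAlgebra k (Option J)) : InvariantRel k J
      (FreeAlgebra.ι k none * a * FreeAlgebra.ι k none) (FreeAlgebra.ι k none * a)

/-- The free invariant algebra `Â` on the set `{x_j | j ∈ J}`: the quotient of the free algebra
by the two-sided ideal generated by all `q̃ q̃ - q̃` and `q̃ a q̃ - q̃ a`. -/
abbrev FreeInvariantAlgebra (k J : Type*) [Field k] : Type _ := RingQuot (InvariantRel k J)

namespace FreeInvariantAlgebra

/-- The idempotent `q̂` of `Â`. -/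
noncomputable def q (k J : Type*) [Field k] : FreeInvariantAlgebra k J :=
  RingQuot.mkAlgHom k (InvariantRel k J) (FreeAlgebra.ι k none)

/-- The generator `x̂_j` of `Â`. -/
noncomputable def x (k : Type*) {J : Type*} [Field k] (j : J) : FreeInvariantAlgebra k J :=
  RingQuot.mkAlgHom k (InvariantRel k J) (FreeAlgebra.ι k (some j))

/-- `q̂` is idempotent. -/
theorem q_mul_q (k J : Type*) [Field k] : q k J * q k J = q k J := by
  simpa [q] using RingQuot.mkAlgHom_rel k (InvariantRel.idem (k := k) (J := J))

/-- Every element of `Â` satisfies `q̂ a q̂ = q̂ a`, so that `(Â, q̂)` is all of `Â`. -/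
theorem q_mul_mul_q (k J : Type*) [Field k] (a : FreeInvariantAlgebra k J) :
    q k J * a * q k J = q k J * a := by
  obtain ⟨a, rfl⟩ := RingQuot.mkAlgHom_surjective k (InvariantRel k J) a
  simpa [q] using RingQuot.mkAlgHom_rel k (InvariantRel.inv (k := k) (J := J) a)

/-- The linear extension `x ↦ x̂` to a Lie algebra `L` of the map sending the basis vector `x_j`
to `x̂_j`. -/
noncomputable def hat {k J L : Type*} [Field k] [AddCommGroup L] [Module k L]
    (b : Module.Basis J k L) : L →ₗ[k] FreeInvariantAlgebra k J :=
  b.constr k (x k)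

/-- The monomial `x̂_{j₁} ⋯ x̂_{jₘ}`; it is `1` for the empty list. -/
noncomputable def word (k : Type*) {J : Type*} [Field k] (js : List J) :
    FreeInvariantAlgebra k J :=
  (js.map (x k)).prod

end FreeInvariantAlgebra

/-- The relations `[x, y]^ = [x̂, ŷ]_{6,κ}` (`x, y ∈ L`) on `Â`. -/
inductive EnvelopingSixRel {k J L : Type*} [Field k] [LieRing L] [LieAlgebra k L]
    (κ : k) (b : Module.Basis J k L) :
    FreeInvariantAlgebra k J → FreeInvariantAlgebra k J → Prop
  | lie (x y : L) : EnvelopingSixRel κ b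
      (FreeInvariantAlgebra.hat b ⁅x, y⁆)
      (bracketSix κ (FreeInvariantAlgebra.q k J)
        (FreeInvariantAlgebra.hat b x) (FreeInvariantAlgebra.hat b y))

/-- The enveloping algebra of sixth kind `U = Â / R`, where `R` is the two-sided ideal generated
by all `[x, y]^ - [x̂, ŷ]_{6,κ}`. -/
abbrev EnvelopingSix {k J L : Type*} [Field k] [LieRing L] [LieAlgebra k L]
    (κ : k) (b : Module.Basis J k L) : Type _ :=
  RingQuot (EnvelopingSixRel κ b)

/-- The projection `a ↦ a + R` from `Â` to `U = Â / R`. -/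
noncomputable def EnvelopingSix.coset {k J L : Type*} [Field k] [LieRing L] [LieAlgebra k L]
    (κ : k) (b : Module.Basis J k L) : FreeInvariantAlgebra k J →ₐ[k] EnvelopingSix κ b :=
  RingQuot.mkAlgHom k (EnvelopingSixRel κ b)

/-- The index data of the model monomials:
`qLeft js` for `q̂ x̂_{j₁} ⋯ x̂_{jₘ}` with `j₁ ≤ ⋯ ≤ jₘ`;
`qMid is j₀ js` for `x̂_{i₁} ⋯ x̂_{iₜ} x̂_{j₀} q̂ x̂_{j₁} ⋯ x̂_{jₘ}` with `i₁ ≤ ⋯ ≤ iₜ` and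
`j₀ ≤ j₁ ≤ ⋯ ≤ jₘ`; `noQ js` for `x̂_{j₁} ⋯ x̂_{jₘ}` with `j₁ ≤ ⋯ ≤ jₘ`. -/
inductive ModelMonomial (J : Type*) [LinearOrder J]
  | qLeft (js : List J) (hjs : js.Pairwise (· ≤ ·))
  | qMid (is : List J) (j₀ : J) (js : List J)
      (his : is.Pairwise (· ≤ ·)) (hjs : (j₀ :: js).Pairwise (· ≤ ·))
  | noQ (js : List J) (hjs : js.Pairwise (· ≤ ·))

/-- The element of `Â` given by a model monomial. -/
noncomputable def ModelMonomial.toFree (k : Type*) {J : Type*} [Field k] [LinearOrder J] :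
    ModelMonomial J → FreeInvariantAlgebra k J
  | .qLeft js _ => FreeInvariantAlgebra.q k J * FreeInvariantAlgebra.word k js
  | .qMid is j₀ js _ _ =>
      FreeInvariantAlgebra.word k is * FreeInvariantAlgebra.x k j₀ *
        FreeInvariantAlgebra.q k J * FreeInvariantAlgebra.word k js
  | .noQ js _ => FreeInvariantAlgebra.word k js

/-! The relations straighten words separately in three regions. Since `q a q = q a`, one gets `q [x,
y] = κ q (xy - yx)`, `[x, y] q = κ (x q y - y q x)` and `[x, y] (1 - q) = (xy - yx) (1 - q)`. So
letters to the right of `q`, together with the letter just before `q`, can be sorted as in the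
enveloping algebra of `L` with bracket scaled by `κ⁻¹`, and letters to the left of `1 - q` can be
sorted as in the enveloping algebra itself. Splitting `1 = q + (1 - q)` and inducting on the length
of the part before `q` gives spanning (`IsSixHom.word_q_word_mem`, `IsSixHom.word_mem`).

For independence, `U` is represented by upper triangular matrices over `U(L) ⊗ U(L)`, with `q ↦
diag(0, 1)` and `x ↦ !![x ⊗ 1, κ⁻¹ (1 ⊗ x); 0, κ⁻¹ (1 ⊗ x)]`. The three kinds of monomials have
leading terms in three different entries, and these are separated by products of
Poincaré–Birkhoff–Witt coordinates (`exists_triangular_functional`). The coordinates come from a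
diamond-lemma argument (`exists_straightens`, `exists_pbwCoord`). -/

/-! ### Diamond lemma. -/

section Rewriting

/-- The diamond lemma for linear rewriting systems: if any two rules that rewrite the same element
become equal under every map compatible with the rules at smaller elements, then there is a map
compatible with all rules, with prescribed values at the irreducible elements. -/
theorem exists_map_of_locally_confluent {W k V : Type*} [Semiring k] [AddCommMonoid V] [Module k V]
    {r : W → W → Prop} (wf : WellFounded r) {Rule : W → (W →₀ k) → Prop}
    (hsupp : ∀ w ρ, Rule w ρ → ∀ w' ∈ ρ.support, r w' w)
    (hconf : ∀ (w : W) (N : W → V),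
      (∀ w', r w' w → ∀ ρ, Rule w' ρ → N w' = Finsupp.linearCombination k N ρ) →
      ∀ ρ₁ ρ₂, Rule w ρ₁ → Rule w ρ₂ →
        Finsupp.linearCombination k N ρ₁ = Finsupp.linearCombination k N ρ₂)
    (e : W → V) :
    ∃ N : W → V, (∀ w, (∀ ρ, ¬ Rule w ρ) → N w = e w) ∧
      ∀ w ρ, Rule w ρ → N w = Finsupp.linearCombination k N ρ := by
  classical
  -- Recursion along an arbitrarily chosen rule; confluence later makes the value independent of the
  -- choice. The default `0` is never reached, by `hsupp`.
  let F : (w : W) → ((w' : W) → r w' w → V) → V := fun w IH =>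
    if h : ∃ ρ, Rule w ρ then
      h.choose.sum fun w' c => if hw : r w' w then c • IH w' hw else 0
    else e w
  have hF : ∀ w, wf.fix F w = F w fun w' _ => wf.fix F w' := fun w => wf.fix_eq F w
  refine ⟨wf.fix F, fun w hw => ?_, fun w => ?_⟩
  · rw [hF]
    exact dif_neg (by simpa using hw)
  · induction w using wf.induction with
    | _ w ih =>
      intro ρ hρ
      have h : ∃ ρ, Rule w ρ := ⟨ρ, hρ⟩
      have hval : wf.fix F w = Finsupp.linearCombination k (wf.fix F) h.choose := by
        rw [hF]
        simp only [F]
        rw [dif_pos h, Finsupp.linearCombination_apply]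
        exact Finsupp.sum_congr fun w' hw' => dif_pos (hsupp w _ h.choose_spec w' hw')
      rw [hval]
      exact hconf w _ ih _ _ h.choose_spec hρ

end Rewriting

/-! ### Words and the termination order. -/

section Words

variable {J : Type*} [LinearOrder J]

/-- The number of inversions of a word. -/
def inversions : List J → ℕ
  | [] => 0
  | x :: l => l.countP (· < x) + inversions l

theorem inversions_swap_lt {x y : J} (hyx : y < x) (u v : List J) :
    inversions (u ++ y :: x :: v) < inversions (u ++ x :: y :: v) := by
  induction u with
  | nil =>
    simp only [List.nil_append, inversions, List.countP_cons, hyx, hyx.le.not_gt, decide_true,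
      decide_false, if_true]
    simp
    omega
  | cons z u ih =>
    have : (u ++ y :: x :: v).countP (· < z) = (u ++ x :: y :: v).countP (· < z) :=
      ((List.Perm.swap x y v).append_left u).countP_eq _
    simp only [List.cons_append, inversions, this]
    omega

/-- Words are compared by length, then by number of inversions. -/
def wordRank (l : List J) : ℕ ×ₗ ℕ := toLex (l.length, inversions l)

theorem wordRank_lt_of_length_lt {l l' : List J} (h : l.length < l'.length) :
    wordRank l < wordRank l' :=
  Prod.Lex.toLex_lt_toLex.2 (Or.inl h)

theorem wordRank_swap_lt {x y : J} (hyx : y < x) (u v : List J) :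
    wordRank (u ++ y :: x :: v) < wordRank (u ++ x :: y :: v) :=
  Prod.Lex.toLex_lt_toLex.2 (Or.inr ⟨by simp, inversions_swap_lt hyx u v⟩)

theorem wordRank_wellFounded : WellFounded fun l l' : List J => wordRank l < wordRank l' :=
  InvImage.wf wordRank wellFounded_lt

theorem exists_descent_of_not_pairwise {l : List J} (h : ¬ l.Pairwise (· ≤ ·)) :
    ∃ u v x y, y < x ∧ l = u ++ x :: y :: v := by
  rw [← List.isChain_iff_pairwise, List.isChain_iff_forall_rel_of_append_cons_cons] at h
  push Not at h
  obtain ⟨x, y, u, v, hl, hxy⟩ := h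
  exact ⟨u, v, x, y, hxy, hl⟩

theorem not_lt_of_pairwise_append {u v : List J} {x y : J}
    (h : (u ++ x :: y :: v).Pairwise (· ≤ ·)) : ¬ y < x := by
  rw [List.pairwise_append] at h
  simpa using (List.pairwise_cons.1 h.2.1).1 y (by simp)

end Words

/-! ### Functions on words compatible with a scaled bracket. -/

section Straightening

variable {k J L V : Type*} [Field k] [LieRing L] [LieAlgebra k L] [AddCommGroup V] [Module k V]

/-- The linear extension to `a ∈ L` of `j ↦ f (u x_j v)`, for a function `f` on words. -/
noncomputable def insertLie (b : Module.Basis J k L) (f : List J → V) (u v : List J) : L →ₗ[k] V :=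
  b.constr k fun j => f (u ++ j :: v)

@[simp]
theorem insertLie_basis (b : Module.Basis J k L) (f : List J → V) (u v : List J) (j : J) :
    insertLie b f u v (b j) = f (u ++ j :: v) :=
  b.constr_basis k _ j

/-- A function on words that respects `u x y v - u y x v = c • u [x, y] v`. -/
def Straightens (b : Module.Basis J k L) (c : k) (f : List J → V) : Prop :=
  ∀ (u v : List J) (x y : J),
    f (u ++ x :: y :: v) - f (u ++ y :: x :: v) = c • insertLie b f u v ⁅b x, b y⁆

/-- Sorting terminates: swapping a descent lowers the inversions, and the bracket term lowers the
length. The length bound feeds the later inductions. -/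
theorem Straightens.mem_span [LinearOrder J] {b : Module.Basis J k L} {c : k} {f : List J → V}
    (hf : Straightens b c f) (l : List J) :
    f l ∈ Submodule.span k (f '' {s | s.Pairwise (· ≤ ·) ∧ s.length ≤ l.length}) := by
  induction l using (wordRank_wellFounded (J := J)).induction with
  | _ l ih =>
    by_cases hl : l.Pairwise (· ≤ ·)
    · exact Submodule.subset_span ⟨l, ⟨hl, le_rfl⟩, rfl⟩
    obtain ⟨u, v, x, y, hyx, rfl⟩ := exists_descent_of_not_pairwise hl
    have mono : ∀ {l' l : List J}, l'.length ≤ l.length →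
        Submodule.span k (f '' {s | s.Pairwise (· ≤ ·) ∧ s.length ≤ l'.length}) ≤
          Submodule.span k (f '' {s | s.Pairwise (· ≤ ·) ∧ s.length ≤ l.length}) :=
      fun h => Submodule.span_mono (Set.image_mono fun s hs => ⟨hs.1, hs.2.trans h⟩)
    rw [sub_eq_iff_eq_add.1 (hf u v x y)]
    refine add_mem (Submodule.smul_mem _ _ ?_) (mono (by simp) (ih _ (wordRank_swap_lt hyx u v)))
    rw [insertLie, Module.Basis.constr_apply]
    refine Submodule.sum_mem _ fun j _ => Submodule.smul_mem _ _ ?_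
    exact mono (by simp) (ih _ (wordRank_lt_of_length_lt (by simp)))

end Straightening

/-! ### Confluence of sorting. -/

section PBW

variable {k J L V : Type*} [Field k] [LieRing L] [LieAlgebra k L] [AddCommGroup V] [Module k V]

/-- The swap of two adjacent letters extends linearly to a swap of an element of `L` and a
letter. -/
theorem insertLie_sub_insertLie {b : Module.Basis J k L} {N : List J → V} {u v : List J}
    (h : ∀ x y, N (u ++ x :: y :: v) - N (u ++ y :: x :: v) = insertLie b N u v ⁅b x, b y⁆)
    (a : L) (y : J) :
    insertLie b N u (y :: v) a - insertLie b N (u ++ [y]) v a = insertLie b N u v ⁅a, b y⁆ := by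
  have : insertLie b N u (y :: v) - insertLie b N (u ++ [y]) v =
      -(insertLie b N u v).comp (LieAlgebra.ad k L (b y) : L →ₗ[k] L) := by
    refine b.ext fun x => ?_
    simpa [← map_neg] using h x y
  simpa [← map_neg] using congrArg (fun g : L →ₗ[k] V => g a) this

theorem linearCombination_single_add_mapDomain_insert (b : Module.Basis J k L) (N : List J → V) (u v : List J)
    (x y : J) :
    Finsupp.linearCombination k N (Finsupp.single (u ++ y :: x :: v) 1 +
      Finsupp.mapDomain (fun j => u ++ j :: v) (b.repr ⁅b x, b y⁆)) =
      N (u ++ y :: x :: v) + insertLie b N u v ⁅b x, b y⁆ := by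
  rw [map_add, Finsupp.linearCombination_single, one_smul, Finsupp.linearCombination_mapDomain,
    insertLie, Module.Basis.constr_def]
  simp [Finsupp.linearCombination_mapDomain, Function.comp_def]

/-- Rewriting two disjoint adjacent pairs of a word commutes. -/
theorem insertLie_comm (b : Module.Basis J k L) (N : List J → V) (u m v : List J) {x y z t : J}
    (h₁ : ∀ j, N (u ++ x :: y :: (m ++ j :: v)) =
      N (u ++ y :: x :: (m ++ j :: v)) + insertLie b N u (m ++ j :: v) ⁅b x, b y⁆)
    (h₂ : ∀ j, N (u ++ j :: (m ++ z :: t :: v)) =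
      N (u ++ j :: (m ++ t :: z :: v)) + insertLie b N (u ++ j :: m) v ⁅b z, b t⁆) :
    insertLie b N u (m ++ z :: t :: v) ⁅b x, b y⁆ +
        insertLie b N (u ++ y :: x :: m) v ⁅b z, b t⁆ =
      insertLie b N u (m ++ t :: z :: v) ⁅b x, b y⁆ +
        insertLie b N (u ++ x :: y :: m) v ⁅b z, b t⁆ := by
  have e₁ : insertLie b N (u ++ x :: y :: m) v ⁅b z, b t⁆ =
      insertLie b N (u ++ y :: x :: m) v ⁅b z, b t⁆ +
      (b.constr k fun j => insertLie b N u (m ++ j :: v) ⁅b x, b y⁆) ⁅b z, b t⁆ := by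
    rw [← LinearMap.add_apply]
    congr 1
    exact b.ext fun j => by simpa using h₁ j
  have e₂ : insertLie b N u (m ++ z :: t :: v) ⁅b x, b y⁆ =
      insertLie b N u (m ++ t :: z :: v) ⁅b x, b y⁆ +
      (b.constr k fun j => insertLie b N (u ++ j :: m) v ⁅b z, b t⁆) ⁅b x, b y⁆ := by
    rw [← LinearMap.add_apply]
    congr 1
    exact b.ext fun j => by simpa using h₂ j
  have e₃ : (b.constr k fun j => insertLie b N u (m ++ j :: v) ⁅b x, b y⁆) ⁅b z, b t⁆ =
      (b.constr k fun j => insertLie b N (u ++ j :: m) v ⁅b z, b t⁆) ⁅b x, b y⁆ := by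
    simp only [Module.Basis.constr_apply, insertLie, Finsupp.sum, Finset.smul_sum]
    rw [Finset.sum_comm]
    refine Finset.sum_congr rfl fun i _ => Finset.sum_congr rfl fun j _ => ?_
    rw [smul_comm]
    simp
  rw [e₁, e₂, e₃]
  abel

/-- The two ways of rewriting a descending triple of a word agree, by the Jacobi identity. -/
theorem overlap_confluent {b : Module.Basis J k L} {N : List J → V} {u v : List J} {x y z : J}
    (h : ∀ x y, N (u ++ x :: y :: v) - N (u ++ y :: x :: v) = insertLie b N u v ⁅b x, b y⁆)
    (h₁ : N (u ++ y :: x :: z :: v) =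
      N (u ++ y :: z :: x :: v) + insertLie b N (u ++ [y]) v ⁅b x, b z⁆)
    (h₂ : N (u ++ y :: z :: x :: v) =
      N (u ++ z :: y :: x :: v) + insertLie b N u (x :: v) ⁅b y, b z⁆)
    (h₃ : N (u ++ x :: z :: y :: v) =
      N (u ++ z :: x :: y :: v) + insertLie b N u (y :: v) ⁅b x, b z⁆)
    (h₄ : N (u ++ z :: x :: y :: v) =
      N (u ++ z :: y :: x :: v) + insertLie b N (u ++ [z]) v ⁅b x, b y⁆) :
    N (u ++ y :: x :: z :: v) + insertLie b N u (z :: v) ⁅b x, b y⁆ =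
      N (u ++ x :: z :: y :: v) + insertLie b N (u ++ [x]) v ⁅b y, b z⁆ := by
  -- Moving an inserted bracket past the third letter costs an inserted double bracket, so the
  -- discrepancy of the two rewritings is the Jacobi sum inserted between `u` and `v`.
  have e₁ := insertLie_sub_insertLie h ⁅b y, b z⁆ x
  have e₂ := insertLie_sub_insertLie h ⁅b x, b y⁆ z
  have e₃ := insertLie_sub_insertLie h ⁅b x, b z⁆ y
  have jac : ⁅⁅b y, b z⁆, b x⁆ + ⁅⁅b x, b y⁆, b z⁆ - ⁅⁅b x, b z⁆, b y⁆ = 0 := by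
    rw [lie_lie (b x) (b y) (b z), ← lie_skew (b x) ⁅b y, b z⁆, ← lie_skew (b y) ⁅b x, b z⁆]
    abel
  have e := congrArg (insertLie b N u v) jac
  rw [map_sub, map_add, map_zero, ← e₁, ← e₂, ← e₃] at e
  rw [h₁, h₂, h₃, h₄, ← sub_eq_zero, ← e]
  abel

variable [LinearOrder J]

/-- The rewriting rules `u x y v ↦ u y x v + u [x, y] v` for `y < x`. -/
def SwapRule (b : Module.Basis J k L) (w : List J) (ρ : List J →₀ k) : Prop :=
  ∃ u v x y, y < x ∧ w = u ++ x :: y :: v ∧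
    ρ = Finsupp.single (u ++ y :: x :: v) 1 +
      Finsupp.mapDomain (fun j => u ++ j :: v) (b.repr ⁅b x, b y⁆)

theorem swapRule_support (b : Module.Basis J k L) (w : List J) (ρ : List J →₀ k)
    (h : SwapRule b w ρ) : ∀ w' ∈ ρ.support, wordRank w' < wordRank w := by
  classical
  obtain ⟨u, v, x, y, hyx, rfl, rfl⟩ := h
  intro w' hw'
  rcases Finset.mem_union.1 (Finsupp.support_add hw') with h | h
  · rw [Finset.mem_singleton.1 (Finsupp.support_single_subset h)]
    exact wordRank_swap_lt hyx u v
  · obtain ⟨j, -, rfl⟩ := Finset.mem_image.1 (Finsupp.mapDomain_support h)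
    exact wordRank_lt_of_length_lt (by simp)

/-- The bracket is alternating, so the rule at descents forces the swap relation for all pairs. -/
theorem swap_of_descents {b : Module.Basis J k L} {N : List J → V} {u v : List J}
    (h : ∀ x y, y < x →
      N (u ++ x :: y :: v) = N (u ++ y :: x :: v) + insertLie b N u v ⁅b x, b y⁆) (x y : J) :
    N (u ++ x :: y :: v) - N (u ++ y :: x :: v) = insertLie b N u v ⁅b x, b y⁆ := by
  rcases lt_trichotomy y x with hyx | rfl | hxy
  · simp [h x y hyx]
  · simp
  · simp [h y x hxy, ← map_neg]

/-- The second descent starts `a.length` letters after the first: they coincide, overlap in one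
letter (Jacobi), or are disjoint (the rewritings commute). -/
theorem swapRule_confluent_of_append (b : Module.Basis J k L) (N : List J → V)
    {u₁ v₁ a v₂ : List J} {x₁ y₁ x₂ y₂ : J} (h₁ : y₁ < x₁) (h₂ : y₂ < x₂)
    (hw : x₁ :: y₁ :: v₁ = a ++ x₂ :: y₂ :: v₂)
    (ih : ∀ u v x y, y < x → wordRank (u ++ x :: y :: v) < wordRank (u₁ ++ x₁ :: y₁ :: v₁) →
      N (u ++ x :: y :: v) = N (u ++ y :: x :: v) + insertLie b N u v ⁅b x, b y⁆) :
    N (u₁ ++ y₁ :: x₁ :: v₁) + insertLie b N u₁ v₁ ⁅b x₁, b y₁⁆ =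
      N ((u₁ ++ a) ++ y₂ :: x₂ :: v₂) + insertLie b N (u₁ ++ a) v₂ ⁅b x₂, b y₂⁆ := by
  match a, hw with
  | [], hw =>
    obtain ⟨rfl, rfl, rfl⟩ : x₁ = x₂ ∧ y₁ = y₂ ∧ v₁ = v₂ := by simpa using hw
    simp
  | [c], hw =>
    obtain ⟨rfl, rfl, rfl⟩ : x₁ = c ∧ y₁ = x₂ ∧ v₁ = y₂ :: v₂ := by simpa using hw
    have swap₁ : wordRank (u₁ ++ y₁ :: x₁ :: y₂ :: v₂) < wordRank (u₁ ++ x₁ :: y₁ :: y₂ :: v₂) :=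
      wordRank_swap_lt h₁ u₁ _
    have swap₂ : wordRank (u₁ ++ x₁ :: y₂ :: y₁ :: v₂) < wordRank (u₁ ++ x₁ :: y₁ :: y₂ :: v₂) := by
      simpa using wordRank_swap_lt h₂ (u₁ ++ [x₁]) v₂
    have swap₃ : wordRank (u₁ ++ y₁ :: y₂ :: x₁ :: v₂) < wordRank (u₁ ++ y₁ :: x₁ :: y₂ :: v₂) := by
      simpa using wordRank_swap_lt (h₂.trans h₁) (u₁ ++ [y₁]) v₂
    have swap₄ : wordRank (u₁ ++ y₂ :: x₁ :: y₁ :: v₂) < wordRank (u₁ ++ x₁ :: y₂ :: y₁ :: v₂) :=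
      wordRank_swap_lt (h₂.trans h₁) u₁ _
    have key := overlap_confluent (b := b) (N := N) (u := u₁) (v := v₂) (x := x₁) (y := y₁)
      (z := y₂)
      (swap_of_descents fun x y hyx => ih u₁ v₂ x y hyx (wordRank_lt_of_length_lt (by simp)))
      (by simpa using ih (u₁ ++ [y₁]) v₂ x₁ y₂ (h₂.trans h₁) (by simpa using swap₁))
      (ih u₁ (x₁ :: v₂) y₁ y₂ h₂ (swap₃.trans swap₁))
      (ih u₁ (y₁ :: v₂) x₁ y₂ (h₂.trans h₁) swap₂)
      (by simpa using ih (u₁ ++ [y₂]) v₂ x₁ y₁ h₁ (by simpa using swap₄.trans swap₂))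
    simpa using key
  | c :: d :: m, hw =>
    obtain ⟨rfl, rfl, rfl⟩ : x₁ = c ∧ y₁ = d ∧ v₁ = m ++ x₂ :: y₂ :: v₂ := by simpa using hw
    have key := insertLie_comm b N u₁ m v₂ (x := x₁) (y := y₁) (z := x₂) (t := y₂)
      (fun j => ih u₁ _ x₁ y₁ h₁ (wordRank_lt_of_length_lt (by simp)))
      (fun j => by
        simpa using ih (u₁ ++ j :: m) v₂ x₂ y₂ h₂ (wordRank_lt_of_length_lt (by simp)))
    have e₁ := ih (u₁ ++ y₁ :: x₁ :: m) v₂ x₂ y₂ h₂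
      (by simpa using wordRank_swap_lt h₁ u₁ (m ++ x₂ :: y₂ :: v₂))
    have e₂ := ih u₁ (m ++ y₂ :: x₂ :: v₂) x₁ y₁ h₁
      (by simpa using wordRank_swap_lt h₂ (u₁ ++ x₁ :: y₁ :: m) v₂)
    simp only [List.append_assoc, List.cons_append] at e₁ e₂ ⊢
    rw [e₁, e₂, add_assoc, add_assoc, add_comm (insertLie b N (u₁ ++ y₁ :: x₁ :: m) _ _), key]

/-- The core of Poincaré–Birkhoff–Witt: sorted words are exactly the irreducible ones, so confluence
lets their values be prescribed freely. -/
theorem exists_straightens (b : Module.Basis J k L) (e : List J → V) :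
    ∃ N : List J → V, Straightens b 1 N ∧ ∀ l, l.Pairwise (· ≤ ·) → N l = e l := by
  have hconf : ∀ (w : List J) (N : List J → V),
      (∀ w', wordRank w' < wordRank w → ∀ ρ, SwapRule b w' ρ →
        N w' = Finsupp.linearCombination k N ρ) →
      ∀ ρ₁ ρ₂, SwapRule b w ρ₁ → SwapRule b w ρ₂ →
        Finsupp.linearCombination k N ρ₁ = Finsupp.linearCombination k N ρ₂ := by
    rintro w N ih ρ₁ ρ₂ ⟨u₁, v₁, x₁, y₁, h₁, rfl, rfl⟩ ⟨u₂, v₂, x₂, y₂, h₂, hw, rfl⟩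
    have ih' : ∀ u v x y, y < x →
        wordRank (u ++ x :: y :: v) < wordRank (u₁ ++ x₁ :: y₁ :: v₁) →
        N (u ++ x :: y :: v) = N (u ++ y :: x :: v) + insertLie b N u v ⁅b x, b y⁆ :=
      fun u v x y hyx hlt => by
        rw [ih _ hlt _ ⟨u, v, x, y, hyx, rfl, rfl⟩, linearCombination_single_add_mapDomain_insert]
    rw [linearCombination_single_add_mapDomain_insert, linearCombination_single_add_mapDomain_insert]
    rcases List.append_eq_append_iff.1 hw with ⟨a, rfl, ha⟩ | ⟨a, rfl, ha⟩
    · exact swapRule_confluent_of_append b N h₁ h₂ ha ih'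
    · exact (swapRule_confluent_of_append b N h₂ h₁ ha (by rwa [hw] at ih')).symm
  obtain ⟨N, hirr, hN⟩ := exists_map_of_locally_confluent (k := k) wordRank_wellFounded
    (swapRule_support b) hconf e
  refine ⟨N, fun u v => ?_, fun l hl => hirr l ?_⟩
  · simp only [one_smul]
    refine swap_of_descents fun x y hyx => ?_
    rw [hN _ _ ⟨u, v, x, y, hyx, rfl, rfl⟩, linearCombination_single_add_mapDomain_insert]
  · rintro ρ ⟨u, v, x, y, hyx, rfl, -⟩
    exact not_lt_of_pairwise_append hl hyx

end PBW

/-! ### Poincaré–Birkhoff–Witt coordinates on the universal enveloping algebra. -/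

section UniversalEnveloping

variable {k J L V : Type*} [Field k] [LieRing L] [LieAlgebra k L] [AddCommGroup V] [Module k V]

/-- A bracket relation for a linear map needs to be checked on a basis only. -/
theorem map_lie_of_basis {A : Type*} [Ring A] [Algebra k A] (b : Module.Basis J k L)
    (φ : L →ₗ[k] A) (h : ∀ i j, φ ⁅b i, b j⁆ = φ (b i) * φ (b j) - φ (b j) * φ (b i)) (x y : L) :
    φ ⁅x, y⁆ = φ x * φ y - φ y * φ x := by
  have key : (LieModule.toEnd k L L : L →ₗ[k] L →ₗ[k] L).compr₂ φ =
      (LinearMap.mul k A - (LinearMap.mul k A).flip).compl₁₂ φ φ :=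
    b.ext fun i => b.ext fun j => by simpa using h i j
  simpa using congrArg (fun g : L →ₗ[k] L →ₗ[k] A => g x y) key

/-- The space of functions on words that respect the swaps `u x y v - u y x v = u [x, y] v`. -/
def straighteningSpace (V : Type*) [AddCommGroup V] [Module k V] (b : Module.Basis J k L) :
    Submodule k (List J → V) where
  carrier := {f | Straightens b 1 f}
  zero_mem' u v x y := by
    have : insertLie b (0 : List J → V) u v = 0 := b.ext fun j => by simp
    simp [this]
  add_mem' {f g} hf hg u v x y := by
    have : insertLie b (f + g) u v = insertLie b f u v + insertLie b g u v :=
      b.ext fun j => by simp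
    rw [this, LinearMap.add_apply, smul_add, ← hf, ← hg]
    simp only [Pi.add_apply]
    abel
  smul_mem' c f hf u v x y := by
    have : insertLie b (c • f) u v = c • insertLie b f u v := b.ext fun j => by simp
    rw [this, LinearMap.smul_apply, smul_comm, ← hf, Pi.smul_apply, Pi.smul_apply, smul_sub]

/-- The operator `f ↦ f (· x_j)`. -/
def straighteningSpace.shift (V : Type*) [AddCommGroup V] [Module k V] (b : Module.Basis J k L)
    (j : J) : Module.End k (straighteningSpace V b) where
  toFun f := ⟨fun l => f.1 (l ++ [j]), fun u v x y => by
    have : insertLie b (fun l => f.1 (l ++ [j])) u v = insertLie b f.1 u (v ++ [j]) :=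
      b.ext fun i => by simp
    rw [this]
    simpa using f.2 u (v ++ [j]) x y⟩
  map_add' _ _ := rfl
  map_smul' _ _ := rfl

theorem straighteningSpace.constr_shift_apply (b : Module.Basis J k L) (a : L)
    (f : straighteningSpace V b) (l : List J) :
    (b.constr k (shift V b) a f).1 l = insertLie b f.1 l [] a := by
  simp only [insertLie, Module.Basis.constr_apply, Finsupp.sum, LinearMap.sum_apply,
    AddSubmonoidClass.coe_finsetSum, Finset.sum_apply]
  rfl

section

attribute [local instance 100] LieRing.ofAssociativeRing

/-- The action of `L` on functions on words by right multiplication of the argument. -/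
noncomputable def straighteningSpace.action (V : Type*) [AddCommGroup V] [Module k V]
    (b : Module.Basis J k L) : L →ₗ⁅k⁆ Module.End k (straighteningSpace V b) where
  toLinearMap := b.constr k (shift V b)
  map_lie' {x y} := by
    refine (map_lie_of_basis (A := Module.End k (straighteningSpace V b)) b _
      (fun i j => ?_) x y).trans
      (LieRing.of_associative_ring_bracket _ _).symm
    refine LinearMap.ext fun f => Subtype.ext (funext fun l => ?_)
    have := f.2 l [] i j
    rw [one_smul] at this
    rw [constr_shift_apply, ← this, b.constr_basis, b.constr_basis]
    simp [shift]

end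

/-- The image of a word in the universal enveloping algebra. -/
noncomputable def envelopingWord (b : Module.Basis J k L) (l : List J) :
    UniversalEnvelopingAlgebra k L :=
  (l.map fun j => UniversalEnvelopingAlgebra.ι k (b j)).prod

/-- A function on words that respects the swaps factors through the universal enveloping
algebra. -/
theorem Straightens.exists_linearMap {b : Module.Basis J k L} {f : List J → V}
    (hf : Straightens b 1 f) :
    ∃ F : UniversalEnvelopingAlgebra k L →ₗ[k] V, ∀ l, F (envelopingWord b l) = f l := by
  let Φ := UniversalEnvelopingAlgebra.lift k (straighteningSpace.action V b)
  have hΦ : ∀ l l' : List J, ∀ g : straighteningSpace V b,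
      (Φ (envelopingWord b l) g).1 l' = g.1 (l' ++ l) := by
    intro l
    induction l with
    | nil => intro l' g; simp [envelopingWord]
    | cons j l ih =>
      intro l' g
      have e : Φ (envelopingWord b (j :: l)) =
          straighteningSpace.shift V b j * Φ (envelopingWord b l) := by
        simp only [envelopingWord, List.map_cons, List.prod_cons, map_mul]
        congr 1
        refine (UniversalEnvelopingAlgebra.lift_ι_apply k _ _).trans ?_
        exact b.constr_basis k _ j
      rw [e]
      exact (ih (l' ++ [j]) g).trans (by simp)
  -- The functional is `a ↦ (Φ a f) []`: acting on `f` and evaluating at the empty word recovers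
  -- `f`.
  exact ⟨(LinearMap.proj []).comp ((straighteningSpace V b).subtype.comp
    ((LinearMap.applyₗ (⟨f, hf⟩ : straighteningSpace V b)).comp Φ.toLinearMap)),
    fun l => (hΦ l [] ⟨f, hf⟩).trans rfl⟩

/-- The coordinate functionals of the Poincaré–Birkhoff–Witt basis. -/
theorem exists_pbwCoord [LinearOrder J] (b : Module.Basis J k L) {s : List J}
    (hs : s.Pairwise (· ≤ ·)) :
    ∃ F : UniversalEnvelopingAlgebra k L →ₗ[k] k,
      F (envelopingWord b s) = 1 ∧
      (∀ l, l.Pairwise (· ≤ ·) → l ≠ s → F (envelopingWord b l) = 0) ∧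
      ∀ l, l.length < s.length → F (envelopingWord b l) = 0 := by
  classical
  obtain ⟨N, hN, hNs⟩ := exists_straightens b fun l => if l = s then (1 : k) else 0
  obtain ⟨F, hF⟩ := hN.exists_linearMap
  refine ⟨F, by simp [hF, hNs s hs], fun l hl hne => by simp [hF, hNs l hl, hne], fun l hl => ?_⟩
  rw [hF]
  -- `f l` lies in the span of values at sorted words no longer than `l`, none of which is `s`; the
  -- kernel of the identity is the zero subspace.
  refine Submodule.span_le (p := LinearMap.ker (LinearMap.id : k →ₗ[k] k)).2 ?_ (hN.mem_span l)
  rintro _ ⟨l', ⟨hl', hlen⟩, rfl⟩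
  have : l' ≠ s := by rintro rfl; omega
  exact (hNs l' hl').trans (if_neg this)

end UniversalEnveloping

/-! ### Triangular functionals and the matrix form of the bracket. -/

section LinearIndependence

/-- A family with a triangular system of functionals is linearly independent. -/
theorem linearIndependent_of_triangular {ι k V R : Type*} [Field k] [AddCommGroup V] [Module k V]
    [LinearOrder R] (v : ι → V) (rk : ι → R)
    (h : ∀ i, ∃ F : V →ₗ[k] k, F (v i) ≠ 0 ∧ ∀ j, j ≠ i → rk j ≤ rk i → F (v j) = 0) :
    LinearIndependent k v := by
  classical
  rw [linearIndependent_iff]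
  intro c hc
  by_contra hne
  obtain ⟨i, hi, hmax⟩ := c.support.exists_max_image rk (Finsupp.support_nonempty_iff.2 hne)
  obtain ⟨F, hFi, hF⟩ := h i
  have e : F (Finsupp.linearCombination k v c) = c i * F (v i) := by
    rw [Finsupp.linearCombination_apply, Finsupp.sum, map_sum,
      Finset.sum_eq_single_of_mem i hi]
    · simp
    · intro j hj hji
      simp [hF j hji (hmax j hj)]
  rw [hc, map_zero] at e
  exact (mul_ne_zero (Finsupp.mem_support_iff.1 hi) hFi) e.symm

/-- The product of two functionals, as a functional on a tensor product. -/
noncomputable def tensorFunctional {k U V : Type*} [Field k] [AddCommGroup U] [Module k U]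
    [AddCommGroup V] [Module k V] (F : U →ₗ[k] k) (G : V →ₗ[k] k) : TensorProduct k U V →ₗ[k] k :=
  TensorProduct.lift ((LinearMap.mul k k).compl₁₂ F G)

@[simp]
theorem tensorFunctional_tmul {k U V : Type*} [Field k] [AddCommGroup U] [Module k U]
    [AddCommGroup V] [Module k V] (F : U →ₗ[k] k) (G : V →ₗ[k] k) (u : U) (v : V) :
    tensorFunctional F G (TensorProduct.tmul k u v) = F u * G v := by
  simp [tensorFunctional]

/-- Right multiplication by `1 - q` keeps only the first column, giving the plain commutator at the
top left; the terms with `q` in the middle fill only the second column, with equal entries. -/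
theorem bracketSix_triangular {k A : Type*} [CommRing k] [Ring A] [Algebra k A] (κ : k)
    {x y z x' y' z' : A} (hz : z = x * y - y * x) (hz' : z' = κ • (x' * y') - κ • (y' * x')) :
    !![z, z'; 0, z'] =
      bracketSix κ !![0, 0; 0, 1] !![x, x'; 0, x'] !![y, y'; 0, y'] := by
  ext i j
  fin_cases i <;> fin_cases j <;> simp [bracketSix, hz, hz']

end LinearIndependence

/-! ### The triangular representation and the images of monomials. -/

section Representation

open TensorProduct

variable {k L J : Type*} [Field k] [LieRing L] [LieAlgebra k L]

/-- The matrix algebra that carries the triangular representation of the enveloping algebra of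
sixth kind. -/
abbrev SixMatrix (k L : Type*) [Field k] [LieRing L] [LieAlgebra k L] : Type _ :=
  Matrix (Fin 2) (Fin 2) (UniversalEnvelopingAlgebra k L ⊗[k] UniversalEnvelopingAlgebra k L)

section

attribute [local instance 100] LieRing.ofAssociativeRing

/-- The canonical map of a Lie algebra to its universal enveloping algebra, as a linear map. -/
noncomputable def envelopingι (k : Type*) {L : Type*} [Field k] [LieRing L] [LieAlgebra k L] :
    L →ₗ[k] UniversalEnvelopingAlgebra k L :=
  (UniversalEnvelopingAlgebra.ι k : L →ₗ⁅k⁆ UniversalEnvelopingAlgebra k L)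

theorem envelopingι_lie (x y : L) :
    envelopingι k ⁅x, y⁆ =
      envelopingι k x * envelopingι k y - envelopingι k y * envelopingι k x :=
  (LieHom.map_lie (UniversalEnvelopingAlgebra.ι k) x y).trans
    (LieRing.of_associative_ring_bracket _ _)

end

@[simp]
theorem envelopingWord_nil (b : Module.Basis J k L) : envelopingWord b [] = 1 := rfl

theorem envelopingWord_cons (b : Module.Basis J k L) (j : J) (l : List J) :
    envelopingWord b (j :: l) = envelopingι k (b j) * envelopingWord b l := rfl

/-- The matrix of an element of `L`. -/
noncomputable def lieMatrix (κ : k) : L →ₗ[k] SixMatrix k L where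
  toFun a := !![envelopingι k a ⊗ₜ 1, κ⁻¹ • (1 ⊗ₜ envelopingι k a);
    0, κ⁻¹ • (1 ⊗ₜ envelopingι k a)]
  map_add' a a' := by
    ext i j
    fin_cases i <;> fin_cases j <;> simp [add_tmul, tmul_add]
  map_smul' c a := by
    ext i j
    fin_cases i <;> fin_cases j <;> simp [smul_tmul', smul_comm c]

theorem lieMatrix_apply (κ : k) (a : L) :
    lieMatrix κ a = !![envelopingι k a ⊗ₜ 1, κ⁻¹ • (1 ⊗ₜ envelopingι k a);
      0, κ⁻¹ • (1 ⊗ₜ envelopingι k a)] := rfl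

theorem lieMatrix_lie {κ : k} (hκ : κ ≠ 0) (x y : L) :
    lieMatrix κ ⁅x, y⁆ = bracketSix κ !![0, 0; 0, 1] (lieMatrix κ x) (lieMatrix κ y) := by
  refine bracketSix_triangular κ ?_ ?_
  · simp [envelopingι_lie, sub_tmul]
  · simp [envelopingι_lie, tmul_sub, smul_sub, smul_smul, hκ]

/-- The triangular representation on the free algebra. -/
noncomputable def freeToMatrix (κ : k) (b : Module.Basis J k L) :
    FreeAlgebra k (Option J) →ₐ[k] SixMatrix k L :=
  FreeAlgebra.lift k fun o => o.elim !![0, 0; 0, 1] fun j => lieMatrix κ (b j)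

/-- Upper triangularity of the image is what yields `q a q = q a`. -/
theorem freeToMatrix_one_zero (κ : k) (b : Module.Basis J k L) (a : FreeAlgebra k (Option J)) :
    freeToMatrix κ b a 1 0 = 0 := by
  induction a with
  | grade0 r => simp [Matrix.algebraMap_matrix_apply]
  | grade1 o => cases o <;> simp [freeToMatrix, lieMatrix]
  | mul a a' h h' => simp [Matrix.mul_apply, Fin.sum_univ_two, h, h']
  | add a a' h h' => simp [h, h']

/-- The triangular representation on the free invariant algebra. -/
noncomputable def invariantToMatrix (κ : k) (b : Module.Basis J k L) :
    FreeInvariantAlgebra k J →ₐ[k] SixMatrix k L :=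
  RingQuot.liftAlgHom k ⟨freeToMatrix κ b, by
    have hq : freeToMatrix κ b (FreeAlgebra.ι k none) = !![0, 0; 0, 1] := by
      simp [freeToMatrix]
    rintro _ _ (_ | a)
    · rw [map_mul, hq]
      ext i j
      fin_cases i <;> fin_cases j <;> simp
    · have := freeToMatrix_one_zero κ b a
      rw [map_mul, map_mul, hq, Matrix.eta_fin_two (freeToMatrix κ b a), this]
      simp⟩

@[simp]
theorem invariantToMatrix_q (κ : k) (b : Module.Basis J k L) :
    invariantToMatrix κ b (FreeInvariantAlgebra.q k J) = !![0, 0; 0, 1] := by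
  rw [invariantToMatrix, FreeInvariantAlgebra.q, RingQuot.liftAlgHom_mkAlgHom_apply]
  simp [freeToMatrix]

@[simp]
theorem invariantToMatrix_x (κ : k) (b : Module.Basis J k L) (j : J) :
    invariantToMatrix κ b (FreeInvariantAlgebra.x k j) = lieMatrix κ (b j) := by
  rw [invariantToMatrix, FreeInvariantAlgebra.x, RingQuot.liftAlgHom_mkAlgHom_apply]
  simp [freeToMatrix]

@[simp]
theorem invariantToMatrix_hat (κ : k) (b : Module.Basis J k L) (a : L) :
    invariantToMatrix κ b (FreeInvariantAlgebra.hat b a) = lieMatrix κ a := by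
  have : (invariantToMatrix κ b).toLinearMap ∘ₗ FreeInvariantAlgebra.hat b = lieMatrix κ :=
    b.ext fun j => by simp [FreeInvariantAlgebra.hat]
  exact congrArg (fun g : L →ₗ[k] SixMatrix k L => g a) this

/-- The triangular representation of the enveloping algebra of sixth kind. -/
noncomputable def envelopingSixToMatrix {κ : k} (hκ : κ ≠ 0) (b : Module.Basis J k L) :
    EnvelopingSix κ b →ₐ[k] SixMatrix k L :=
  RingQuot.liftAlgHom k ⟨invariantToMatrix κ b, by
    rintro _ _ ⟨x, y⟩
    simp only [bracketSix, map_add, map_sub, map_mul, map_smul, invariantToMatrix_hat,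
      invariantToMatrix_q]
    exact lieMatrix_lie hκ x y⟩

theorem envelopingSixToMatrix_coset {κ : k} (hκ : κ ≠ 0) (b : Module.Basis J k L)
    (a : FreeInvariantAlgebra k J) :
    envelopingSixToMatrix hκ b (EnvelopingSix.coset κ b a) = invariantToMatrix κ b a :=
  RingQuot.liftAlgHom_mkAlgHom_apply ..

theorem word_cons (j : J) (l : List J) :
    FreeInvariantAlgebra.word k (j :: l) =
      FreeInvariantAlgebra.x k j * FreeInvariantAlgebra.word k l := by
  simp [FreeInvariantAlgebra.word]

/-- The tensors `w ⊗ u` with `w` a word of length less than `n`. -/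
def shortTensors (b : Module.Basis J k L) (n : ℕ) :
    Submodule k (UniversalEnvelopingAlgebra k L ⊗[k] UniversalEnvelopingAlgebra k L) :=
  Submodule.span k {t | ∃ l : List J, ∃ u, l.length < n ∧ t = envelopingWord b l ⊗ₜ u}

theorem tmul_mul_mem_shortTensors (b : Module.Basis J k L) {n : ℕ} (j : J)
    {t : UniversalEnvelopingAlgebra k L ⊗[k] UniversalEnvelopingAlgebra k L}
    (ht : t ∈ shortTensors b n) :
    (envelopingι k (b j) ⊗ₜ[k] 1) * t ∈ shortTensors b (n + 1) := by
  refine Submodule.span_le (p := (shortTensors b (n + 1)).comap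
    (LinearMap.mulLeft k (envelopingι k (b j) ⊗ₜ[k] 1))).2 ?_ ht
  rintro _ ⟨l, u, hl, rfl⟩
  exact Submodule.subset_span ⟨j :: l, u, by simpa using hl, by simp [envelopingWord_cons]⟩

theorem mul_tmul_mem_shortTensors (b : Module.Basis J k L) {n : ℕ}
    (u : UniversalEnvelopingAlgebra k L)
    {t : UniversalEnvelopingAlgebra k L ⊗[k] UniversalEnvelopingAlgebra k L}
    (ht : t ∈ shortTensors b n) : t * (1 ⊗ₜ[k] u) ∈ shortTensors b n := by
  refine Submodule.span_le (p := (shortTensors b n).comap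
    (LinearMap.mulRight k (1 ⊗ₜ[k] u))).2 ?_ ht
  rintro _ ⟨l, u', hl, rfl⟩
  exact Submodule.subset_span ⟨l, u' * u, hl, by simp⟩

theorem tensorFunctional_eq_zero_of_mem_shortTensors {b : Module.Basis J k L} {n : ℕ}
    {F : UniversalEnvelopingAlgebra k L →ₗ[k] k}
    (hF : ∀ l, l.length < n → F (envelopingWord b l) = 0)
    (G : UniversalEnvelopingAlgebra k L →ₗ[k] k)
    {t : UniversalEnvelopingAlgebra k L ⊗[k] UniversalEnvelopingAlgebra k L}
    (ht : t ∈ shortTensors b n) : tensorFunctional F G t = 0 := by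
  refine Submodule.span_le (p := LinearMap.ker (tensorFunctional F G)).2 ?_ ht
  rintro _ ⟨l, u, hl, rfl⟩
  simp [hF l hl]

/-- The diagonal is multiplicative. Off it, a new letter either lengthens the left factors of `t` by
one or creates a tensor with left factor `1`, so these stay shorter than the word. -/
theorem invariantToMatrix_word (κ : k) (b : Module.Basis J k L) (l : List J) :
    ∃ t ∈ shortTensors b l.length,
      invariantToMatrix κ b (FreeInvariantAlgebra.word k l) =
        !![envelopingWord b l ⊗ₜ 1, t; 0, κ⁻¹ ^ l.length • (1 ⊗ₜ envelopingWord b l)] := by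
  induction l with
  | nil =>
    refine ⟨0, zero_mem _, ?_⟩
    simp [FreeInvariantAlgebra.word, Matrix.one_fin_two, Algebra.TensorProduct.one_def]
  | cons j l ih =>
    obtain ⟨t, ht, e⟩ := ih
    refine ⟨(envelopingι k (b j) ⊗ₜ[k] 1) * t + (κ⁻¹ • (1 ⊗ₜ envelopingι k (b j))) *
      (κ⁻¹ ^ l.length • (1 ⊗ₜ envelopingWord b l)), ?_, ?_⟩
    · refine add_mem (tmul_mul_mem_shortTensors b j ht) ?_
      simp only [Algebra.mul_smul_comm, Algebra.smul_mul_assoc, Algebra.TensorProduct.tmul_mul_tmul,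
        one_mul]
      exact Submodule.smul_mem _ _ (Submodule.smul_mem _ _
        (Submodule.subset_span ⟨[], _, by simp, by simp; rfl⟩))
    · rw [word_cons, map_mul, e, invariantToMatrix_x, lieMatrix_apply, Matrix.mul_fin_two]
      simp [envelopingWord_cons, pow_succ, smul_smul]

theorem invariantToMatrix_qLeft (κ : k) (b : Module.Basis J k L) (l : List J) :
    invariantToMatrix κ b (FreeInvariantAlgebra.q k J * FreeInvariantAlgebra.word k l) =
      !![0, 0; 0, κ⁻¹ ^ l.length • (1 ⊗ₜ envelopingWord b l)] := by
  obtain ⟨t, -, e⟩ := invariantToMatrix_word κ b l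
  rw [map_mul, e, invariantToMatrix_q, Matrix.mul_fin_two]
  simp

/-- The error `t` has left factors shorter than `is`, hence is invisible to a coordinate functional
of `is`. -/
theorem invariantToMatrix_qMid (κ : k) (b : Module.Basis J k L) (is : List J) (j : J)
    (js : List J) :
    let M := invariantToMatrix κ b (FreeInvariantAlgebra.word k is * FreeInvariantAlgebra.x k j *
      FreeInvariantAlgebra.q k J * FreeInvariantAlgebra.word k js)
    M 0 0 = 0 ∧ ∃ t ∈ shortTensors b is.length, M 0 1 =
      κ⁻¹ ^ (js.length + 1) • (envelopingWord b is ⊗ₜ envelopingWord b (j :: js)) + t := by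
  obtain ⟨t, ht, e⟩ := invariantToMatrix_word κ b is
  intro M
  simp only [M]
  rw [mul_assoc _ (FreeInvariantAlgebra.q k J), map_mul, map_mul, e, invariantToMatrix_qLeft,
    invariantToMatrix_x, lieMatrix_apply, Matrix.mul_fin_two, Matrix.mul_fin_two]
  refine ⟨by simp, t * (1 ⊗ₜ (κ⁻¹ ^ (js.length + 1) • envelopingWord b (j :: js))),
    mul_tmul_mem_shortTensors b _ ht, ?_⟩
  simp [add_mul, mul_assoc, envelopingWord_cons, pow_succ, smul_smul]

end Representation

/-! ### Linear independence of the model monomials. -/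

section LinearIndependence

variable {k L J : Type*} [Field k] [LieRing L] [LieAlgebra k L] [LinearOrder J]

/-- The order in which the coefficients of a linear relation between model monomials are shown to
vanish, from the top down. -/
def ModelMonomial.rank : ModelMonomial J → WithTop ℕ
  | .qLeft _ _ => 0
  | .qMid is _ _ _ _ => ((is.length + 1 : ℕ) : WithTop ℕ)
  | .noQ _ _ => ⊤

/-- Entry `0 0` sees only monomials without `q`. Entry `0 1` vanishes on those starting with `q`
and, up to shorter left factors, separates the middle ones. Entry `1 1` separates those starting
with `q` once the others are gone. -/
theorem exists_triangular_functional {κ : k} (hκ : κ ≠ 0) (b : Module.Basis J k L)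
    (m : ModelMonomial J) :
    ∃ F : SixMatrix k L →ₗ[k] k, F (invariantToMatrix κ b (m.toFree k)) ≠ 0 ∧
      ∀ m', m' ≠ m → m'.rank ≤ m.rank → F (invariantToMatrix κ b (m'.toFree k)) = 0 := by
  obtain ⟨E, hE, -, -⟩ := exists_pbwCoord b (s := []) List.Pairwise.nil
  rw [envelopingWord_nil] at hE
  cases m with
  | qLeft js hjs =>
    obtain ⟨G, hG, hG', -⟩ := exists_pbwCoord b hjs
    refine ⟨tensorFunctional E G ∘ₗ Matrix.entryLinearMap k _ 1 1, ?_, ?_⟩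
    · simp [ModelMonomial.toFree, invariantToMatrix_qLeft, hE, hG, hκ]
    · rintro (⟨js', hjs'⟩ | ⟨is', j', js', his', hjs'⟩ | ⟨js', hjs'⟩) hne hrk
      · have : js' ≠ js := by rintro rfl; exact hne rfl
        simp [ModelMonomial.toFree, invariantToMatrix_qLeft, hG' js' hjs' this]
      · simp [ModelMonomial.rank] at hrk
      · simp [ModelMonomial.rank] at hrk
  | qMid is j js his hjs =>
    obtain ⟨F, hF, hF', hF''⟩ := exists_pbwCoord b his
    obtain ⟨G, hG, hG', -⟩ := exists_pbwCoord b hjs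
    refine ⟨tensorFunctional F G ∘ₗ Matrix.entryLinearMap k _ 0 1, ?_, ?_⟩
    · obtain ⟨-, t, ht, e⟩ := invariantToMatrix_qMid κ b is j js
      simp only [ModelMonomial.toFree, e, LinearMap.comp_apply, Matrix.entryLinearMap_apply]
      simp [hF, hG, hκ,
        tensorFunctional_eq_zero_of_mem_shortTensors hF'' G ht]
    · rintro (⟨js', hjs'⟩ | ⟨is', j', js', his', hjs'⟩ | ⟨js', hjs'⟩) hne hrk
      · simp [ModelMonomial.toFree, invariantToMatrix_qLeft]
      · have hlen : is'.length ≤ is.length := by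
          have : ((is'.length + 1 : ℕ) : WithTop ℕ) ≤ ((is.length + 1 : ℕ) : WithTop ℕ) := hrk
          simpa using Nat.cast_le.1 this
        obtain ⟨-, t, ht, e⟩ := invariantToMatrix_qMid κ b is' j' js'
        have h₀ := tensorFunctional_eq_zero_of_mem_shortTensors
          (fun l hl => hF'' l (hl.trans_le hlen)) G ht
        have h₁ : F (envelopingWord b is') * G (envelopingWord b (j' :: js')) = 0 := by
          by_cases h : is' = is
          · subst h
            rw [hG' _ hjs' (by rintro h; cases h; exact hne rfl), mul_zero]
          · rw [hF' _ his' h, zero_mul]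
        simp only [ModelMonomial.toFree, e, LinearMap.comp_apply, Matrix.entryLinearMap_apply]
        simp [h₀, h₁]
      · simp [ModelMonomial.rank] at hrk
  | noQ js hjs =>
    obtain ⟨F, hF, hF', -⟩ := exists_pbwCoord b hjs
    refine ⟨tensorFunctional F E ∘ₗ Matrix.entryLinearMap k _ 0 0, ?_, ?_⟩
    · obtain ⟨t, -, e⟩ := invariantToMatrix_word κ b js
      simp [ModelMonomial.toFree, e, hE, hF]
    · rintro (⟨js', hjs'⟩ | ⟨is', j', js', his', hjs'⟩ | ⟨js', hjs'⟩) hne -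
      · simp [ModelMonomial.toFree, invariantToMatrix_qLeft]
      · obtain ⟨e, -⟩ := invariantToMatrix_qMid κ b is' j' js'
        simp only [ModelMonomial.toFree, e, LinearMap.comp_apply, Matrix.entryLinearMap_apply,
          map_zero]
      · have : js' ≠ js := by rintro rfl; exact hne rfl
        obtain ⟨t, -, e⟩ := invariantToMatrix_word κ b js'
        simp [ModelMonomial.toFree, e, hF' js' hjs' this]

theorem linearIndependent_modelMonomial {κ : k} (hκ : κ ≠ 0) (b : Module.Basis J k L) :
    LinearIndependent k fun m : ModelMonomial J => EnvelopingSix.coset κ b (m.toFree k) := by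
  have h : LinearIndependent k fun m : ModelMonomial J => invariantToMatrix κ b (m.toFree k) :=
    linearIndependent_of_triangular _ ModelMonomial.rank fun m => exists_triangular_functional hκ b m
  refine LinearIndependent.of_comp (envelopingSixToMatrix hκ b).toLinearMap ?_
  have e : ⇑(envelopingSixToMatrix hκ b).toLinearMap ∘
      (fun m : ModelMonomial J => EnvelopingSix.coset κ b (m.toFree k)) =
        fun m => invariantToMatrix κ b (m.toFree k) :=
    funext fun m => envelopingSixToMatrix_coset hκ b (m.toFree k)
  rw [e]
  exact h

end LinearIndependence

/-! ### Straightening around `q` and `1 - q`. -/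

section BracketSix

variable {k A L J : Type*} [Field k] [Ring A] [Algebra k A] [LieRing L] [LieAlgebra k L]

/-- The product of the images of the letters of a word under a linear map `h : L → A`. -/
noncomputable def basisWord (b : Module.Basis J k L) (h : L →ₗ[k] A) (l : List J) : A :=
  (l.map fun j => h (b j)).prod

@[simp]
theorem basisWord_nil (b : Module.Basis J k L) (h : L →ₗ[k] A) : basisWord b h [] = 1 := rfl

@[simp]
theorem basisWord_cons (b : Module.Basis J k L) (h : L →ₗ[k] A) (j : J) (l : List J) :
    basisWord b h (j :: l) = h (b j) * basisWord b h l := by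
  simp [basisWord]

@[simp]
theorem basisWord_append (b : Module.Basis J k L) (h : L →ₗ[k] A) (l l' : List J) :
    basisWord b h (l ++ l') = basisWord b h l * basisWord b h l' := by
  simp [basisWord]

theorem insertLie_basisWord (b : Module.Basis J k L) (h : L →ₗ[k] A) (p r : A) (u v : List J)
    (a : L) : insertLie b (fun l => p * basisWord b h l * r) u v a =
      p * basisWord b h u * h a * basisWord b h v * r := by
  have : insertLie b (fun l => p * basisWord b h l * r) u v =
      LinearMap.mulRight k (basisWord b h v * r) ∘ₗ LinearMap.mulLeft k (p * basisWord b h u) ∘ₗ h :=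
    b.ext fun j => by simp [mul_assoc]
  rw [this]
  simp [mul_assoc]

theorem straightens_basisWord {b : Module.Basis J k L} {h : L →ₗ[k] A} {c : k} {p r : A}
    (H : ∀ u v x y, p * basisWord b h u * (h x * h y - h y * h x) * basisWord b h v * r =
      c • (p * basisWord b h u * h ⁅x, y⁆ * basisWord b h v * r)) :
    Straightens b c fun l => p * basisWord b h l * r := by
  intro u v x y
  rw [insertLie_basisWord, ← H]
  simp only [basisWord_append, basisWord_cons]
  noncomm_ring

/-- A linear map from a Lie algebra that turns the bracket into `bracketSix`, for an element `q`
with `q a q = q a` for all `a`. -/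
structure IsSixHom (κ : k) (q : A) (h : L →ₗ[k] A) : Prop where
  q_mul_q : q * q = q
  q_mul_mul_q : ∀ a, q * a * q = q * a
  map_lie : ∀ x y, h ⁅x, y⁆ = bracketSix κ q (h x) (h y)

namespace IsSixHom

variable {κ : k} {q : A} {h : L →ₗ[k] A}

theorem q_mul_mul_q_mul (H : IsSixHom κ q h) (a c : A) : q * (a * (q * c)) = q * (a * c) := by
  rw [← mul_assoc a, ← mul_assoc q, ← mul_assoc q a q, H.q_mul_mul_q, mul_assoc]

theorem q_mul_lie (H : IsSixHom κ q h) (x y : L) :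
    q * h ⁅x, y⁆ = κ • (q * (h x * h y - h y * h x)) := by
  have e₁ := H.q_mul_mul_q (h x * h y)
  have e₂ := H.q_mul_mul_q (h y * h x)
  simp only [mul_assoc] at e₁ e₂
  rw [H.map_lie, bracketSix]
  simp only [mul_add, mul_sub, mul_smul_comm, mul_assoc, H.q_mul_mul_q_mul, smul_sub, e₁, e₂]
  abel

theorem lie_mul_q (H : IsSixHom κ q h) (x y : L) :
    h ⁅x, y⁆ * q = κ • (h x * q * h y - h y * q * h x) := by
  have e₁ : ∀ a, a * q * q = a * q := fun a => by rw [mul_assoc, H.q_mul_q]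
  have e₂ : ∀ a c, a * q * c * q = a * q * c := fun a c => by
    rw [mul_assoc, mul_assoc, ← mul_assoc q, H.q_mul_mul_q, mul_assoc]
  rw [H.map_lie, bracketSix]
  simp only [add_mul, sub_mul, smul_mul_assoc, smul_sub, e₁, e₂]
  abel

theorem lie_mul_one_sub_q (H : IsSixHom κ q h) (x y : L) :
    h ⁅x, y⁆ * (1 - q) = (h x * h y - h y * h x) * (1 - q) := by
  rw [mul_sub, mul_one, H.lie_mul_q, H.map_lie, bracketSix]
  simp only [mul_sub, sub_mul, smul_sub, mul_one]
  abel

/-- Since `q a (1 - q) = 0`, a factor `1 - q` on the right can be copied to any place further left,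
next to the bracket being straightened. -/
theorem mul_one_sub_q (H : IsSixHom κ q h) (a : A) : a * (1 - q) = (1 - q) * a * (1 - q) := by
  have := H.q_mul_mul_q a
  simp only [mul_sub, sub_mul, mul_one, one_mul, this]
  abel

theorem straightens_left (H : IsSixHom κ q h) (hκ : κ ≠ 0) (b : Module.Basis J k L) (p : A) :
    Straightens b κ⁻¹ fun l => p * q * basisWord b h l := by
  have := straightens_basisWord (b := b) (h := h) (c := κ⁻¹) (p := p * q) (r := 1)
    fun u v x y => by
      have e : ∀ a, p * q * basisWord b h u * a = p * (q * basisWord b h u) * (q * a) := fun a => by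
        simp only [mul_assoc, H.q_mul_mul_q_mul]
      rw [e, e, H.q_mul_lie]
      simp [smul_smul, hκ]
  simpa using this

theorem straightens_right (H : IsSixHom κ q h) (b : Module.Basis J k L) (r : A) :
    Straightens b 1 fun l => basisWord b h l * ((1 - q) * r) := by
  have := straightens_basisWord (b := b) (h := h) (c := 1) (p := 1) (r := (1 - q) * r)
    fun u v x y => by
      have e : ∀ a, 1 * basisWord b h u * a * basisWord b h v * ((1 - q) * r) =
          basisWord b h u * (a * (1 - q)) * (basisWord b h v * (1 - q) * r) := fun a => by
        have := congrArg (· * r) (H.mul_one_sub_q (basisWord b h v))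
        simp only [mul_assoc] at this
        simp only [mul_assoc, one_mul, ← this]
      rw [e, e, H.lie_mul_one_sub_q, one_smul]
  simpa using this

/-- The words `w x q w'` as a function of the nonempty word `x w'`. -/
noncomputable def _root_.midWord (b : Module.Basis J k L) (h : L →ₗ[k] A) (q w : A) : List J → A
  | [] => 0
  | j :: l => w * h (b j) * q * basisWord b h l

/-- Swapping the first two letters exchanges the one before `q` with the one after it, which is
`lie_mul_q`; every other swap happens to the right of `q`. -/
theorem straightens_mid (H : IsSixHom κ q h) (hκ : κ ≠ 0) (b : Module.Basis J k L) (w : A) :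
    Straightens b κ⁻¹ (midWord b h q w) := by
  rintro (_ | ⟨i, u⟩) v x y
  · have e : insertLie b (midWord b h q w) [] v =
        LinearMap.mulRight k (q * basisWord b h v) ∘ₗ LinearMap.mulLeft k w ∘ₗ h :=
      b.ext fun j => by simp [midWord, mul_assoc]
    have e' : w * h ⁅b x, b y⁆ * (q * basisWord b h v) =
        w * (h ⁅b x, b y⁆ * q) * basisWord b h v := by simp only [mul_assoc]
    simp only [e, LinearMap.comp_apply, LinearMap.mulRight_apply, LinearMap.mulLeft_apply, e',
      H.lie_mul_q, midWord, List.nil_append, basisWord_cons]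
    simp only [mul_smul_comm, smul_mul_assoc, smul_smul, inv_mul_cancel₀ hκ, one_smul]
    noncomm_ring
  · exact H.straightens_left hκ b (w * h (b i)) u v x y

section Span

variable {S : Submodule k A}

/-- The words with at most one occurrence of `q` span the subalgebra generated by `q` and the
image of `L`. -/
theorem mem_of_freeAlgebra (H : IsSixHom κ q h) (b : Module.Basis J k L)
    (hS : ∀ w, basisWord b h w ∈ S) (hS' : ∀ w w', basisWord b h w * q * basisWord b h w' ∈ S)
    (π : FreeAlgebra k (Option J) →ₐ[k] A) (hπq : π (FreeAlgebra.ι k none) = q)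
    (hπx : ∀ j, π (FreeAlgebra.ι k (some j)) = h (b j)) (a : FreeAlgebra k (Option J)) :
    π a ∈ S := by
  let T : Submodule k A := Submodule.span k (Set.range (basisWord b h) ∪
    Set.range fun p : List J × List J => basisWord b h p.1 * q * basisWord b h p.2)
  have hw : ∀ w, basisWord b h w ∈ T := fun w => Submodule.subset_span (Or.inl ⟨w, rfl⟩)
  have hwq : ∀ w w', basisWord b h w * q * basisWord b h w' ∈ T :=
    fun w w' => Submodule.subset_span (Or.inr ⟨(w, w'), rfl⟩)
  have hTS : T ≤ S := by
    refine Submodule.span_le.2 (Set.union_subset ?_ ?_)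
    · rintro _ ⟨w, rfl⟩
      exact hS w
    · rintro _ ⟨⟨w, w'⟩, rfl⟩
      exact hS' w w'
  -- It suffices that `T` contains `1` and is stable under left multiplication; a second `q` is
  -- absorbed by `q w q w' = q w w'`.
  have stable : ∀ t ∈ T, π a * t ∈ T := by
    induction a with
    | grade0 c =>
      intro t ht
      rw [AlgHom.commutes, ← Algebra.smul_def]
      exact T.smul_mem c ht
    | grade1 o =>
      intro t ht
      refine Submodule.span_le (p := T.comap (LinearMap.mulLeft k (π (FreeAlgebra.ι k o)))).2
        (Set.union_subset ?_ ?_) ht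
      · rintro _ ⟨w, rfl⟩
        cases o with
        | none => simpa [hπq] using hwq [] w
        | some j => simpa [hπx] using hw (j :: w)
      · rintro _ ⟨⟨w, w'⟩, rfl⟩
        cases o with
        | none => simpa [hπq, mul_assoc, H.q_mul_mul_q_mul] using hwq [] (w ++ w')
        | some j => simpa [hπx, mul_assoc] using hwq (j :: w) w'
    | mul a a' iha iha' =>
      intro t ht
      rw [map_mul, mul_assoc]
      exact iha _ (iha' _ ht)
    | add a a' iha iha' =>
      intro t ht
      rw [map_add, add_mul]
      exact add_mem (iha _ ht) (iha' _ ht)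
  simpa using hTS (stable 1 (hw []))

variable [LinearOrder J] {b : Module.Basis J k L}

/-- First sort the last letter of `w` together with `w'`. Then insert `1 = (1 - q) + q` after the
rest of `w`: the `1 - q` part lets that rest be sorted, and every correction has `q` after a
strictly shorter word, since sorting never lengthens. -/
theorem word_q_word_mem (H : IsSixHom κ q h) (hκ : κ ≠ 0)
    (hleft : ∀ js, js.Pairwise (· ≤ ·) → q * basisWord b h js ∈ S)
    (hmid : ∀ is j js, is.Pairwise (· ≤ ·) → (j :: js).Pairwise (· ≤ ·) →
      basisWord b h is * h (b j) * q * basisWord b h js ∈ S)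
    (w w' : List J) : basisWord b h w * q * basisWord b h w' ∈ S := by
  induction hn : w.length using Nat.strong_induction_on generalizing w w' with
  | _ n ih =>
    subst hn
    rcases List.eq_nil_or_concat' w with rfl | ⟨w, j, rfl⟩
    · refine Submodule.span_le.2 ?_ ((H.straightens_left hκ b 1).mem_span w')
      rintro _ ⟨js, ⟨hjs, -⟩, rfl⟩
      simpa using hleft js hjs
    · have e : basisWord b h (w ++ [j]) * q * basisWord b h w' =
          midWord b h q (basisWord b h w) (j :: w') := by
        simp [midWord]
      rw [e]
      refine Submodule.span_le.2 ?_
        ((H.straightens_mid hκ b (basisWord b h w)).mem_span (j :: w'))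
      rintro _ ⟨_ | ⟨j₀, js⟩, ⟨hjs, -⟩, rfl⟩
      -- The empty word counts as sorted; its default value under `midWord` is `0`.
      · exact zero_mem S
      have split : ∀ w₁, basisWord b h w₁ * ((1 - q) * (h (b j₀) * q * basisWord b h js)) =
          basisWord b h w₁ * h (b j₀) * q * basisWord b h js -
            basisWord b h w₁ * q * basisWord b h (j₀ :: js) := fun w₁ => by
        have := H.q_mul_mul_q_mul (h (b j₀)) (basisWord b h js)
        simp only [sub_mul, one_mul, mul_sub, mul_assoc, this, basisWord_cons]
      rw [SetLike.mem_coe, midWord, ← sub_add_cancel (_ * basisWord b h js), ← split]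
      refine add_mem ?_ (ih _ (by simp) w _ rfl)
      refine Submodule.span_le.2 ?_ ((H.straightens_right b _).mem_span w)
      rintro _ ⟨w₁, ⟨hw₁, hlen⟩, rfl⟩
      simp only [SetLike.mem_coe, split]
      exact sub_mem (hmid w₁ j₀ js hw₁ hjs) (ih _ (by simp; omega) w₁ _ rfl)

/-- Here `w = w (1 - q) + w q`: the first part sorts, and words ending in `q` are already covered.
-/
theorem word_mem (H : IsSixHom κ q h) (hκ : κ ≠ 0)
    (hleft : ∀ js, js.Pairwise (· ≤ ·) → q * basisWord b h js ∈ S)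
    (hmid : ∀ is j js, is.Pairwise (· ≤ ·) → (j :: js).Pairwise (· ≤ ·) →
      basisWord b h is * h (b j) * q * basisWord b h js ∈ S)
    (hno : ∀ js, js.Pairwise (· ≤ ·) → basisWord b h js ∈ S)
    (w : List J) : basisWord b h w ∈ S := by
  have split : ∀ w₁, basisWord b h w₁ * ((1 - q) * 1) =
      basisWord b h w₁ - basisWord b h w₁ * q * basisWord b h [] := fun w₁ => by
    simp [mul_sub]
  rw [← sub_add_cancel (basisWord b h w), ← split]
  refine add_mem ?_ (H.word_q_word_mem hκ hleft hmid w _)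
  refine Submodule.span_le.2 ?_ ((H.straightens_right b 1).mem_span w)
  rintro _ ⟨w₁, ⟨hw₁, -⟩, rfl⟩
  simp only [SetLike.mem_coe, split]
  exact sub_mem (hno w₁ hw₁) (H.word_q_word_mem hκ hleft hmid w₁ _)

end Span

end IsSixHom

end BracketSix

/-! ### Spanning in the enveloping algebra of sixth kind. -/

section Span

variable {k L J : Type*} [Field k] [LieRing L] [LieAlgebra k L]

theorem isSixHom_coset (κ : k) (b : Module.Basis J k L) :
    IsSixHom κ (EnvelopingSix.coset κ b (FreeInvariantAlgebra.q k J))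
      ((EnvelopingSix.coset κ b).toLinearMap ∘ₗ FreeInvariantAlgebra.hat b) where
  q_mul_q := by rw [← map_mul, FreeInvariantAlgebra.q_mul_q]
  q_mul_mul_q a := by
    obtain ⟨a, rfl⟩ := RingQuot.mkAlgHom_surjective k (EnvelopingSixRel κ b) a
    have := congrArg (EnvelopingSix.coset κ b) (FreeInvariantAlgebra.q_mul_mul_q k J a)
    rwa [map_mul, map_mul] at this
  map_lie x y := by
    have := RingQuot.mkAlgHom_rel k (EnvelopingSixRel.lie (κ := κ) (b := b) x y)
    refine this.trans ?_
    simp only [bracketSix, map_add, map_sub, map_mul, map_smul]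
    rfl

theorem coset_word (κ : k) (b : Module.Basis J k L) (l : List J) :
    EnvelopingSix.coset κ b (FreeInvariantAlgebra.word k l) =
      basisWord b ((EnvelopingSix.coset κ b).toLinearMap ∘ₗ FreeInvariantAlgebra.hat b) l := by
  induction l with
  | nil => simp [FreeInvariantAlgebra.word]
  | cons j l ih => simp [word_cons, ih, FreeInvariantAlgebra.hat]

theorem span_modelMonomial [LinearOrder J] {κ : k} (hκ : κ ≠ 0) (b : Module.Basis J k L) :
    Submodule.span k
      (Set.range fun m : ModelMonomial J => EnvelopingSix.coset κ b (m.toFree k)) = ⊤ := by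
  rw [Submodule.eq_top_iff']
  intro a
  obtain ⟨a, rfl⟩ := RingQuot.mkAlgHom_surjective k (EnvelopingSixRel κ b) a
  obtain ⟨a, rfl⟩ := RingQuot.mkAlgHom_surjective k (InvariantRel k J) a
  have H := isSixHom_coset κ b
  have hx : ∀ j, EnvelopingSix.coset κ b (FreeInvariantAlgebra.x k j) =
      ((EnvelopingSix.coset κ b).toLinearMap ∘ₗ FreeInvariantAlgebra.hat b) (b j) := fun j => by
    simp [FreeInvariantAlgebra.hat]
  have sub := fun m : ModelMonomial J => Submodule.subset_span (R := k)
    (s := Set.range fun m : ModelMonomial J => EnvelopingSix.coset κ b (m.toFree k)) ⟨m, rfl⟩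
  have hleft := fun (js : List J) (hjs : js.Pairwise (· ≤ ·)) => by
    simpa only [ModelMonomial.toFree, map_mul, coset_word] using sub (.qLeft js hjs)
  have hmid := fun (is : List J) (j : J) (js : List J) (his : is.Pairwise (· ≤ ·)) (hjs : (j :: js).Pairwise (· ≤ ·)) => by
    simpa only [ModelMonomial.toFree, map_mul, coset_word, hx] using sub (.qMid is j js his hjs)
  have hno := fun (js : List J) (hjs : js.Pairwise (· ≤ ·)) => by
    simpa only [ModelMonomial.toFree, map_mul, coset_word] using sub (.noQ js hjs)
  exact H.mem_of_freeAlgebra b (H.word_mem hκ hleft hmid hno) (H.word_q_word_mem hκ hleft hmid)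
    ((EnvelopingSix.coset κ b).comp (RingQuot.mkAlgHom k (InvariantRel k J))) rfl hx a

end Span

theorem proposition6p3 {k L J : Type*} [Field k] [LieRing L] [LieAlgebra k L] [LinearOrder J]
    (b : Module.Basis J k L) (κ : k) (hκ : κ ≠ 0) :
    LinearIndependent k
        (fun m : ModelMonomial J => EnvelopingSix.coset κ b (m.toFree k)) ∧
      Submodule.span k
        (Set.range fun m : ModelMonomial J => EnvelopingSix.coset κ b (m.toFree k)) = ⊤ :=
  ⟨linearIndependent_modelMonomial hκ b, span_modelMonomial hκ b⟩
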